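/- Let $d\ge 1$ and let $\Omega\subset\mathbb{R}^d$ be a nonempty bounded open set (for example a bounded domain). Let $\sigma:\mathbb{R}\to(0,\infty)$ be injective and $C^\infty$, and let $c\ge 0$. Let $\mathcal{P}_s(\Omega)$ be the set of finite signed Borel measures $\mu$ on $\mathbb{R}^d$ that vanish outside some compact subset of $\Omega$, are absolutely continuous with respect to Lebesgue measure, with density $f=d\mu/dx$, and satisfy $\int_\Omega \sigma(f(\tau))\,d\tau<\infty$ (which is automatic if $f$ is bounded); identify $\mu$ with $f$. For $f\in\mathcal{P}_s(\Omega)$ put $$ (P_\sigma f)(t)=\frac{\sigma(f(t))+c}{\int_\Omega(\sigma(f(\tau))+c)\,d\tau},\qquad t\in\Omega, $$ and for $f,g\in\mathcal{P}_s(\Omega)$ put $W_\sigma(f,g)=W_2(P_\sigma f,P_\sigma g)$, where $$ W_2(\mu,\nu)=\Bigl(\inf_{\pi}\int_{\mathbb{R}^d\times\mathbb{R}^d}|x-y|^2\,d\pi(x,y)\Bigr)^{1/2}, $$ the infimum being over all Borel measures $\pi$ on $\mathbb{R}^d\times\mathbb{R}^d$ with marginals $\mu$ and $\nu$, and $P_\sigma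 f$ is regarded as the measure on $\Omega$ with that density. Then $P_\sigma f$ is a probability density with finite second moment for every $f\in\mathcal{P}_s(\Omega)$, and $W_\sigma$ is a metric on $\mathcal{P}_s(\Omega)$: it is finite, nonnegative and symmetric, it satisfies the triangle inequality, and $W_\sigma(f,g)=0$ if and only if $f=g$ (as measures, i.e. almost everywhere). -/

import Mathlib

open MeasureTheory Set
open scoped ENNReal ContDiff

noncomputable section

namespace SignedW2

/-- `ℝ^d` with the Euclidean norm. -/
abbrev E (d : ℕ) : Type := EuclideanSpace ℝ (Fin d)

/-- The conditions on a scaling function: `σ : ℝ → ℝ⁺` is one-to-one and `C^∞`. -/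
structure IsScaling (σ : ℝ → ℝ) : Prop where
  pos : ∀ y, 0 < σ y
  injective : Function.Injective σ
  smooth : ContDiff ℝ ∞ σ

/-- The set `Γ(μ, ν)` of transference plans: measures on the product with marginals `μ` and `ν`. -/
def plans {X : Type*} [MeasurableSpace X] (μ ν : Measure X) : Set (Measure (X × X)) :=
  {π | π.map Prod.fst = μ ∧ π.map Prod.snd = ν}

/-- The quadratic Wasserstein distance
`W₂(μ, ν) = (inf_{π ∈ Γ(μ, ν)} ∫ |x - y|² dπ(x, y))^{1/2}`, with values in `[0, ∞]`. -/
def W2 {X : Type*} [MeasurableSpace X] [PseudoEMetricSpace X] (μ ν : Measure X) : ℝ≥0∞ :=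
  (⨅ π ∈ plans μ ν, ∫⁻ z, edist z.1 z.2 ^ 2 ∂π) ^ (1 / 2 : ℝ)

variable {d : ℕ}

/-- The (Lebesgue) density `f = dμ` of a signed measure. -/
def density (μ : SignedMeasure (E d)) : E d → ℝ := μ.rnDeriv volume

/-- The signed measure `μ` is compactly supported in `Ω`: it vanishes off a compact subset
of `Ω`. -/
def CompactlySupportedIn (Ω : Set (E d)) (μ : SignedMeasure (E d)) : Prop :=
  ∃ K : Set (E d), IsCompact K ∧ K ⊆ Ω ∧ ∀ A, MeasurableSet A → Disjoint A K → μ A = 0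

/-- The signals on `Ω`: finite signed measures that are compactly supported in `Ω`, have a density
`f` with respect to Lebesgue measure, and lie in the domain of the normalization operator, i.e.
the total mass `∫_Ω σ(f)` is finite. (On a bounded `Ω` the last condition holds for every bounded
`f`, whatever `σ` is.) -/
def signals (σ : ℝ → ℝ) (Ω : Set (E d)) : Set (SignedMeasure (E d)) :=
  {μ | CompactlySupportedIn Ω μ ∧
    μ ≪ᵥ (volume : Measure (E d)).toENNRealVectorMeasure ∧
    IntegrableOn (fun t => σ (density μ t)) Ω}

/-- The normalization operator on functions:
`(P_σ f)(t) = (σ(f(t)) + c) / ∫_Ω (σ(f(τ)) + c) dτ`. -/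
def normalize (σ : ℝ → ℝ) (c : ℝ) (Ω : Set (E d)) (f : E d → ℝ) (t : E d) : ℝ :=
  (σ (f t) + c) / ∫ τ in Ω, (σ (f τ) + c)

/-- The measure on `Ω` whose density is `P_σ f`, where `f` is the density of `μ`. -/
def normalizedMeasure (σ : ℝ → ℝ) (c : ℝ) (Ω : Set (E d)) (μ : SignedMeasure (E d)) :
    Measure (E d) :=
  (volume.restrict Ω).withDensity fun t => ENNReal.ofReal (normalize σ c Ω (density μ) t)

/-- `W_σ(f, g) = W₂(P_σ f, P_σ g)`. -/
def Wsigma (σ : ℝ → ℝ) (c : ℝ) (Ω : Set (E d)) (μ ν : SignedMeasure (E d)) : ℝ≥0∞ :=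
  W2 (normalizedMeasure σ c Ω μ) (normalizedMeasure σ c Ω ν)

end SignedW2

end

/-! `W2` is a finite metric on probability measures with finite second moment, so what remains is
that normalization lands there and is injective. The triangle inequality comes from gluing plans
(`exists_glued_plan`) and Minkowski in L². Separation needs no optimal plan: small cost forces a
small Lévy–Prokhorov distance (`eq_of_W2_eq_zero`). Injectivity (`eq_of_normalizedMeasure_eq`) uses
compact support: near the boundary of `Ω` both densities vanish, which fixes the normalizing
constant; injectivity of `σ` does the rest. -/

open Metric

namespace SignedW2

/-! ### The quadratic Wasserstein distance -/

section Wasserstein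

variable {X : Type*} [MeasurableSpace X]

lemma swap_mem_plans {μ ν : Measure X} {π : Measure (X × X)} (hπ : π ∈ plans μ ν) :
    π.map Prod.swap ∈ plans ν μ := by
  refine ⟨?_, ?_⟩
  · rw [Measure.map_map measurable_fst measurable_swap]; exact hπ.2
  · rw [Measure.map_map measurable_snd measurable_swap]; exact hπ.1

lemma isProbabilityMeasure_of_mem_plans {μ ν : Measure X} [IsProbabilityMeasure μ]
    {π : Measure (X × X)} (hπ : π ∈ plans μ ν) : IsProbabilityMeasure π := by
  refine ⟨?_⟩
  have h : π.map Prod.fst univ = 1 := by rw [hπ.1]; exact measure_univ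
  rwa [Measure.map_apply measurable_fst MeasurableSet.univ] at h

lemma prod_mem_plans (μ ν : Measure X) [IsProbabilityMeasure μ] [IsProbabilityMeasure ν] :
    μ.prod ν ∈ plans μ ν := by
  constructor <;> simp

/-- Two transference plans with a common marginal can be glued along it. -/
lemma exists_glued_plan [StandardBorelSpace X] [Nonempty X] {μ ν ρ : Measure X}
    [IsProbabilityMeasure μ] [IsProbabilityMeasure ν]
    {π₁ π₂ : Measure (X × X)} (h₁ : π₁ ∈ plans μ ν) (h₂ : π₂ ∈ plans ν ρ) :
    ∃ γ : Measure ((X × X) × X),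
      γ.map Prod.fst = π₁ ∧ γ.map (fun p => (p.1.2, p.2)) = π₂ := by
  have := isProbabilityMeasure_of_mem_plans h₁
  have := isProbabilityMeasure_of_mem_plans h₂
  -- Given a pair drawn from `π₁`, the third point follows the conditional law of `π₂` given the
  -- second.
  refine ⟨π₁.compProd (π₂.condKernel.comap Prod.snd measurable_snd),
    Measure.fst_compProd _ _, ?_⟩
  have hm : Measurable fun p : (X × X) × X => (p.1.2, p.2) := by fun_prop
  conv_rhs => rw [← π₂.disintegrate π₂.condKernel]
  have hν : π₂.fst = π₁.map Prod.snd := h₂.1.trans h₁.2.symm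
  ext s hs
  rw [Measure.map_apply hm hs, Measure.compProd_apply (hm hs), Measure.compProd_apply hs, hν,
    lintegral_map (ProbabilityTheory.Kernel.measurable_kernel_prodMk_left hs) measurable_snd]
  rfl

variable [PseudoEMetricSpace X]

/-- With the root inside the infimum, inequalities can be checked plan by plan. -/
lemma W2_eq_iInf (μ ν : Measure X) :
    W2 μ ν = ⨅ π : plans μ ν, (∫⁻ z, edist z.1 z.2 ^ 2 ∂(π : Measure (X × X))) ^ (1 / 2 : ℝ) := by
  rw [W2, iInf_subtype']
  exact (ENNReal.orderIsoRpow (1 / 2 : ℝ) (by norm_num)).map_iInf _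

lemma W2_le {μ ν : Measure X} {π : Measure (X × X)} (hπ : π ∈ plans μ ν) :
    W2 μ ν ≤ (∫⁻ z, edist z.1 z.2 ^ 2 ∂π) ^ (1 / 2 : ℝ) := by
  rw [W2_eq_iInf]
  exact iInf_le_of_le ⟨π, hπ⟩ le_rfl

variable [OpensMeasurableSpace X]

lemma W2_self [SecondCountableTopology X] (μ : Measure X) : W2 μ μ = 0 := by
  have hm : Measurable fun x : X => (x, x) := by fun_prop
  have hπ : μ.map (fun x => (x, x)) ∈ plans μ μ := by
    constructor
    · rw [Measure.map_map measurable_fst hm]; exact Measure.map_id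
    · rw [Measure.map_map measurable_snd hm]; exact Measure.map_id
  refine le_antisymm ((W2_le hπ).trans ?_) bot_le
  rw [lintegral_map (by fun_prop) hm]
  simp

lemma W2_comm_le [SecondCountableTopology X] (μ ν : Measure X) : W2 μ ν ≤ W2 ν μ := by
  rw [W2_eq_iInf ν μ]
  refine le_iInf fun π => (W2_le (swap_mem_plans π.2)).trans ?_
  rw [lintegral_map (by fun_prop) measurable_swap]
  simp [edist_comm]

lemma W2_comm [SecondCountableTopology X] (μ ν : Measure X) : W2 μ ν = W2 ν μ :=
  le_antisymm (W2_comm_le μ ν) (W2_comm_le ν μ)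

lemma W2_triangle [SecondCountableTopology X] [StandardBorelSpace X] (μ ν ρ : Measure X)
    [IsProbabilityMeasure μ] [IsProbabilityMeasure ν] :
    W2 μ ρ ≤ W2 μ ν + W2 ν ρ := by
  have : Nonempty X := nonempty_of_isProbabilityMeasure μ
  rw [W2_eq_iInf μ ν, W2_eq_iInf ν ρ, ENNReal.iInf_add]
  refine le_iInf fun π₁ => ?_
  rw [ENNReal.add_iInf]
  refine le_iInf fun π₂ => ?_
  obtain ⟨π₁, h₁⟩ := π₁
  obtain ⟨π₂, h₂⟩ := π₂
  obtain ⟨γ, hγ₁, hγ₂⟩ := exists_glued_plan h₁ h₂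
  have hm : Measurable fun p : (X × X) × X => (p.1.2, p.2) := by fun_prop
  have hm' : Measurable fun p : (X × X) × X => (p.1.1, p.2) := by fun_prop
  have hγ : γ.map (fun p => (p.1.1, p.2)) ∈ plans μ ρ := by
    constructor
    · rw [Measure.map_map measurable_fst hm', ← h₁.1, ← hγ₁,
        Measure.map_map measurable_fst measurable_fst]
      rfl
    · rw [Measure.map_map measurable_snd hm', ← h₂.2, ← hγ₂,
        Measure.map_map measurable_snd hm]
      rfl
  refine (W2_le hγ).trans ?_
  simp only
  rw [← hγ₁, ← hγ₂, lintegral_map (by fun_prop) hm', lintegral_map (by fun_prop) measurable_fst,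
    lintegral_map (by fun_prop) hm]
  -- Minkowski's inequality in L²(`γ`).
  have key := ENNReal.lintegral_Lp_add_le (μ := γ) (p := 2)
    (f := fun p => edist p.1.1 p.1.2) (g := fun p => edist p.1.2 p.2)
    (by fun_prop) (by fun_prop) (by norm_num)
  simp only [ENNReal.rpow_two, Pi.add_apply] at key
  refine le_trans ?_ key
  gcongr
  exact edist_triangle _ _ _

/-- Markov's inequality: cost at most `ε ^ 3` leaves mass at most `ε ^ 3 / ε ^ 2 = ε` on pairs at
distance at least `ε`. -/
lemma meas_le_thickening_add_of_mem_plans [SecondCountableTopology X] {μ ν : Measure X}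
    {π : Measure (X × X)} (hπ : π ∈ plans μ ν) {ε : ℝ≥0∞} (hε : ε ≠ 0) (hε' : ε ≠ ⊤)
    (h : ∫⁻ z, edist z.1 z.2 ^ 2 ∂π ≤ ε ^ 3) {B : Set X} (hB : MeasurableSet B) :
    μ B ≤ ν (thickening ε.toReal B) + ε := by
  have hfar : π {z | ε ^ 2 ≤ edist z.1 z.2 ^ 2} ≤ ε := by
    refine (meas_ge_le_lintegral_div (by fun_prop) (pow_ne_zero 2 hε)
      (ENNReal.pow_ne_top hε')).trans ?_
    refine ENNReal.div_le_of_le_mul (h.trans_eq (by ring))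
  rw [← hπ.1, ← hπ.2, Measure.map_apply measurable_fst hB,
    Measure.map_apply measurable_snd isOpen_thickening.measurableSet]
  refine (measure_mono fun z hz => ?_).trans
    ((measure_union_le _ {z | ε ^ 2 ≤ edist z.1 z.2 ^ 2}).trans (by gcongr))
  by_cases hd : ε ≤ edist z.1 z.2
  · right
    exact pow_le_pow_left₀ bot_le hd 2
  · left
    rw [mem_preimage, mem_thickening_iff_exists_edist_lt]
    refine ⟨z.1, hz, ?_⟩
    rw [ENNReal.ofReal_toReal hε', edist_comm]
    exact not_le.1 hd

end Wasserstein

lemma eq_of_W2_eq_zero {X : Type*} [MeasurableSpace X] [PseudoEMetricSpace X] [BorelSpace X]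
    [SecondCountableTopology X] {μ ν : Measure X}
    [IsProbabilityMeasure μ] [IsProbabilityMeasure ν] (h : W2 μ ν = 0) : μ = ν := by
  have hLP : levyProkhorovEDist μ ν = 0 := by
    refine le_antisymm (levyProkhorovEDist_le_of_forall μ ν 0 fun ε B hε hε' hB => ?_) bot_le
    have h0 : ⨅ π ∈ plans μ ν, ∫⁻ z, edist z.1 z.2 ^ 2 ∂π = 0 := by
      rw [W2, ENNReal.rpow_eq_zero_iff_of_pos (by norm_num)] at h
      exact h
    have hlt : ⨅ π ∈ plans μ ν, ∫⁻ z, edist z.1 z.2 ^ 2 ∂π < ε ^ 3 := by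
      rw [h0]; exact ENNReal.pow_pos hε 3
    simp only [iInf_lt_iff] at hlt
    obtain ⟨π, hπ, hlt⟩ := hlt
    refine ⟨meas_le_thickening_add_of_mem_plans hπ hε.ne' hε'.ne hlt.le hB,
      meas_le_thickening_add_of_mem_plans (swap_mem_plans hπ) hε.ne' hε'.ne ?_ hB⟩
    rw [lintegral_map (by fun_prop) measurable_swap]
    simpa [edist_comm] using hlt.le
  -- Closed sets form a generating π-system, and zero Lévy–Prokhorov distance makes finite measures
  -- agree on them.
  refine ext_of_generate_finite _ (BorelSpace.measurable_eq.trans borel_eq_generateFrom_isClosed)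
    isPiSystem_isClosed (fun s hs => ?_) (by simp)
  exact measure_eq_measure_of_levyProkhorovEDist_eq_zero_of_isClosed hLP hs
    ⟨1, one_pos, measure_ne_top _ _⟩ ⟨1, one_pos, measure_ne_top _ _⟩

lemma W2_ne_top_of_second_moments {F : Type*} [NormedAddCommGroup F] [MeasurableSpace F]
    [OpensMeasurableSpace F] [SecondCountableTopology F] {μ ν : Measure F}
    [IsProbabilityMeasure μ] [IsProbabilityMeasure ν]
    (hμ : ∫⁻ x, ‖x‖ₑ ^ 2 ∂μ < ⊤) (hν : ∫⁻ x, ‖x‖ₑ ^ 2 ∂ν < ⊤) : W2 μ ν ≠ ⊤ := by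
  refine ((W2_le (prod_mem_plans μ ν)).trans_lt (ENNReal.rpow_lt_top_of_nonneg (by norm_num) ?_)).ne
  have key : ∀ z : F × F, edist z.1 z.2 ^ 2 ≤ 2 * (‖z.1‖ₑ ^ 2 + ‖z.2‖ₑ ^ 2) := fun z => by
    have h := ENNReal.rpow_add_le_mul_rpow_add_rpow ‖z.1‖ₑ ‖z.2‖ₑ (p := 2) (by norm_num)
    norm_num at h
    refine le_trans ?_ h
    gcongr
    rw [edist_eq_enorm_sub]
    exact enorm_sub_le
  refine ((lintegral_mono key).trans_lt ?_).ne
  rw [lintegral_const_mul _ (by fun_prop), lintegral_add_left (by fun_prop)]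
  have e₁ : ∫⁻ z : F × F, ‖z.1‖ₑ ^ 2 ∂(μ.prod ν) = ∫⁻ x, ‖x‖ₑ ^ 2 ∂μ := by
    conv_rhs => rw [← (prod_mem_plans μ ν).1]
    rw [lintegral_map (by fun_prop) measurable_fst]
  have e₂ : ∫⁻ z : F × F, ‖z.2‖ₑ ^ 2 ∂(μ.prod ν) = ∫⁻ x, ‖x‖ₑ ^ 2 ∂ν := by
    conv_rhs => rw [← (prod_mem_plans μ ν).2]
    rw [lintegral_map (by fun_prop) measurable_snd]
  rw [e₁, e₂]
  exact ENNReal.mul_lt_top (by simp) (ENNReal.add_lt_top.2 ⟨hμ, hν⟩)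

end SignedW2

namespace SignedW2

/-! ### Signals and their normalization -/

section Signals

variable {d : ℕ} {Ω : Set (E d)} {σ : ℝ → ℝ} {c : ℝ} {μ ν : SignedMeasure (E d)}

lemma integrable_density (μ : SignedMeasure (E d)) : Integrable (density μ) :=
  SignedMeasure.integrable_rnDeriv μ volume

lemma withDensity_density (hμ : μ ∈ signals σ Ω) : volume.withDensityᵥ (density μ) = μ :=
  SignedMeasure.withDensityᵥ_rnDeriv_eq μ volume hμ.2.1

lemma density_ae_eq_zero_compl (hμ : μ ∈ signals σ Ω) {K : Set (E d)} (hK : MeasurableSet K)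
    (h : ∀ A, MeasurableSet A → Disjoint A K → μ A = 0) :
    ∀ᵐ t, t ∉ K → density μ t = 0 := by
  refine (ae_restrict_iff' hK.compl).1 ?_
  refine Integrable.ae_eq_zero_of_forall_setIntegral_eq_zero
    (integrable_density μ).integrableOn fun s hs _ => ?_
  rw [Measure.restrict_restrict hs,
    ← withDensityᵥ_apply (integrable_density μ) (hs.inter hK.compl), withDensity_density hμ]
  exact h _ (hs.inter hK.compl) (disjoint_compl_left.mono_left inter_subset_right)

lemma measurable_sigma_density_add (hσ : IsScaling σ) (c : ℝ) (μ : SignedMeasure (E d)) :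
    Measurable fun t => σ (density μ t) + c :=
  (hσ.smooth.continuous.measurable.comp (SignedMeasure.measurable_rnDeriv μ volume)).add_const c

lemma integrableOn_sigma_density_add (hΩ : Bornology.IsBounded Ω) (hμ : μ ∈ signals σ Ω) (c : ℝ) :
    IntegrableOn (fun t => σ (density μ t) + c) Ω :=
  hμ.2.2.add (integrableOn_const hΩ.measure_lt_top.ne)

lemma integral_sigma_density_add_pos (hΩo : IsOpen Ω) (hΩn : Ω.Nonempty)
    (hΩ : Bornology.IsBounded Ω) (hσ : IsScaling σ) (hc : 0 ≤ c) (hμ : μ ∈ signals σ Ω) :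
    0 < ∫ t in Ω, (σ (density μ t) + c) := by
  have hpos : ∀ t, 0 < σ (density μ t) + c := fun t => add_pos_of_pos_of_nonneg (hσ.pos _) hc
  rw [integral_pos_iff_support_of_nonneg (fun t => (hpos t).le)
    (integrableOn_sigma_density_add hΩ hμ c)]
  have hsupp : Function.support (fun t => σ (density μ t) + c) = univ :=
    eq_univ_of_forall fun t => (hpos t).ne'
  rw [hsupp, Measure.restrict_apply_univ]
  exact hΩo.measure_pos volume hΩn

lemma isProbabilityMeasure_normalizedMeasure (hΩo : IsOpen Ω) (hΩn : Ω.Nonempty)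
    (hΩ : Bornology.IsBounded Ω) (hσ : IsScaling σ) (hc : 0 ≤ c) (hμ : μ ∈ signals σ Ω) :
    IsProbabilityMeasure (normalizedMeasure σ c Ω μ) := by
  have hI := integral_sigma_density_add_pos hΩo hΩn hΩ hσ hc hμ
  refine ⟨?_⟩
  rw [normalizedMeasure, withDensity_apply _ MeasurableSet.univ, Measure.restrict_univ,
    ← ofReal_integral_eq_lintegral_ofReal]
  · simp only [normalize]
    rw [integral_div, div_self hI.ne', ENNReal.ofReal_one]
  · exact (integrableOn_sigma_density_add hΩ hμ c).div_const _
  · exact Filter.Eventually.of_forall fun t =>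
      div_nonneg (add_nonneg (hσ.pos _).le hc) hI.le

lemma lintegral_enorm_sq_lt_top_of_bounded {F : Type*} [SeminormedAddCommGroup F]
    [MeasurableSpace F] {m : Measure F} [IsFiniteMeasure m] {s : Set F}
    (hs : Bornology.IsBounded s) (hm : ∀ᵐ x ∂m, x ∈ s) : ∫⁻ x, ‖x‖ₑ ^ 2 ∂m < ⊤ := by
  obtain ⟨R, hR⟩ := hs.exists_norm_le
  refine lt_of_le_of_lt (lintegral_mono_ae (g := fun _ => ENNReal.ofReal R ^ 2) ?_) ?_
  · filter_upwards [hm] with x hx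
    gcongr
    rw [← ofReal_norm]
    exact ENNReal.ofReal_le_ofReal (hR x hx)
  · rw [lintegral_const]
    exact ENNReal.mul_lt_top (ENNReal.pow_lt_top ENNReal.ofReal_lt_top) (measure_lt_top _ _)

lemma ae_mem_normalizedMeasure (hΩo : IsOpen Ω) :
    ∀ᵐ x ∂(normalizedMeasure σ c Ω μ), x ∈ Ω :=
  (withDensity_absolutelyContinuous _ _).ae_le (ae_restrict_mem hΩo.measurableSet)

/-- Otherwise `Ω` is clopen in a connected space, hence everything, yet bounded; this fails for `d ≥
1`. -/
lemma exists_mem_diff_isCompact [NeZero d] (hΩo : IsOpen Ω) (hΩn : Ω.Nonempty) {K : Set (E d)}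
    (hK : IsCompact K) (hKΩ : K ⊆ Ω) : (Ω \ K).Nonempty := by
  by_contra h
  have hΩK : Ω = K := (sdiff_eq_empty.1 (not_nonempty_iff_eq_empty.1 h)).antisymm hKΩ
  have huniv : Ω = univ := IsClopen.eq_univ ⟨hΩK ▸ hK.isClosed, hΩo⟩ hΩn
  exact NormedSpace.unbounded_univ ℝ (E d) (huniv ▸ hΩK ▸ hK.isBounded)

/-- The normalization operator is injective on signals: outside the supports of two signals,
the densities of their normalizations determine the normalization constants. -/
lemma eq_of_normalizedMeasure_eq [NeZero d] (hΩo : IsOpen Ω) (hΩn : Ω.Nonempty)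
    (hΩ : Bornology.IsBounded Ω) (hσ : IsScaling σ) (hc : 0 ≤ c) (hμ : μ ∈ signals σ Ω)
    (hν : ν ∈ signals σ Ω) (h : normalizedMeasure σ c Ω μ = normalizedMeasure σ c Ω ν) :
    μ = ν := by
  have hA := integral_sigma_density_add_pos hΩo hΩn hΩ hσ hc hμ
  have hB := integral_sigma_density_add_pos hΩo hΩn hΩ hσ hc hν
  have hpos : ∀ y, 0 < σ y + c := fun y => add_pos_of_pos_of_nonneg (hσ.pos y) hc
  have hm : ∀ ρ : SignedMeasure (E d), Measurable fun t =>
      ENNReal.ofReal (normalize σ c Ω (density ρ) t) := fun ρ =>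
    ((measurable_sigma_density_add hσ c ρ).div_const _).ennreal_ofReal
  obtain ⟨K, hK, hKΩ, hμK⟩ := hμ.1
  obtain ⟨L, hL, hLΩ, hνL⟩ := hν.1
  have hfK := density_ae_eq_zero_compl hμ hK.measurableSet hμK
  have hgL := density_ae_eq_zero_compl hν hL.measurableSet hνL
  have hae : ∀ᵐ t, t ∈ Ω → normalize σ c Ω (density μ) t = normalize σ c Ω (density ν) t := by
    refine (ae_restrict_iff' hΩo.measurableSet).1 ?_
    have h' := (withDensity_eq_iff_of_sigmaFinite (hm μ).aemeasurable (hm ν).aemeasurable).1 h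
    filter_upwards [h'] with t ht
    exact (ENNReal.ofReal_eq_ofReal_iff (div_nonneg (hpos _).le hA.le)
      (div_nonneg (hpos _).le hB.le)).1 ht
  have hAB : ∫ t in Ω, (σ (density μ t) + c) = ∫ t in Ω, (σ (density ν t) + c) := by
    have hU : IsOpen (Ω \ (K ∪ L)) := hΩo.sdiff (hK.union hL).isClosed
    have hUpos : volume (Ω \ (K ∪ L)) ≠ 0 := (hU.measure_pos volume
      (exists_mem_diff_isCompact hΩo hΩn (hK.union hL) (union_subset hKΩ hLΩ))).ne'
    -- A set of positive measure contains a point where all the almost-everywhere identities hold;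
    -- there both numerators equal `σ 0 + c`.
    obtain ⟨t, htU, h₁, h₂, h₃⟩ := ((frequently_ae_mem_iff.2 hUpos).and_eventually
      (hfK.and (hgL.and hae))).exists
    have h₄ := h₃ htU.1
    rw [normalize, normalize, h₁ fun hk => htU.2 (Or.inl hk), h₂ fun hk => htU.2 (Or.inr hk),
      div_eq_div_iff hA.ne' hB.ne'] at h₄
    exact (mul_left_cancel₀ (hpos 0).ne' h₄).symm
  rw [← withDensity_density hμ, ← withDensity_density hν]
  refine WithDensityᵥEq.congr_ae ?_
  filter_upwards [hfK, hgL, hae] with t h₁ h₂ h₃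
  by_cases ht : t ∈ Ω
  · have h₄ := h₃ ht
    rw [normalize, normalize, hAB, div_left_inj' hB.ne'] at h₄
    exact hσ.injective (add_right_cancel h₄)
  · rw [h₁ fun hk => ht (hKΩ hk), h₂ fun hk => ht (hLΩ hk)]

end Signals

end SignedW2

/-- On a bounded nonempty open set `Ω ⊆ ℝ^d`, `d ≥ 1`, the operator `P_σ` turns signals into
probability densities with finite second moment, and `W_σ` is a (finite) metric on the signals. -/
theorem theorem4p1 (d : ℕ) (hd : 1 ≤ d) (Ω : Set (SignedW2.E d)) (hΩ_open : IsOpen Ω)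
    (hΩ_nonempty : Ω.Nonempty) (hΩ_bounded : Bornology.IsBounded Ω)
    (σ : ℝ → ℝ) (hσ : SignedW2.IsScaling σ) (c : ℝ) (hc : 0 ≤ c) :
    (∀ μ ∈ SignedW2.signals σ Ω,
      IsProbabilityMeasure (SignedW2.normalizedMeasure σ c Ω μ) ∧
      ∫⁻ x, ‖x‖ₑ ^ 2 ∂(SignedW2.normalizedMeasure σ c Ω μ) < ⊤) ∧
    ∃ m : MetricSpace (SignedW2.signals σ Ω),
      ∀ μ ν : SignedW2.signals σ Ω, m.edist μ ν = SignedW2.Wsigma σ c Ω μ ν := by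
  have hprob : ∀ μ ∈ SignedW2.signals σ Ω,
      IsProbabilityMeasure (SignedW2.normalizedMeasure σ c Ω μ) := fun μ hμ =>
    SignedW2.isProbabilityMeasure_normalizedMeasure hΩ_open hΩ_nonempty hΩ_bounded hσ hc hμ
  have hmom : ∀ μ ∈ SignedW2.signals σ Ω,
      ∫⁻ x, ‖x‖ₑ ^ 2 ∂(SignedW2.normalizedMeasure σ c Ω μ) < ⊤ := fun μ hμ => by
    have := hprob μ hμ
    exact SignedW2.lintegral_enorm_sq_lt_top_of_bounded hΩ_bounded
      (SignedW2.ae_mem_normalizedMeasure hΩ_open)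
  refine ⟨fun μ hμ => ⟨hprob μ hμ, hmom μ hμ⟩, ?_⟩
  have : NeZero d := ⟨by omega⟩
  have hprob' : ∀ μ : SignedW2.signals σ Ω,
      IsProbabilityMeasure (SignedW2.normalizedMeasure σ c Ω μ) := fun μ => hprob μ μ.2
  let e : EMetricSpace (SignedW2.signals σ Ω) :=
    { edist := fun μ ν => SignedW2.Wsigma σ c Ω μ ν
      edist_self := fun μ => SignedW2.W2_self _
      edist_comm := fun μ ν => SignedW2.W2_comm _ _
      edist_triangle := fun μ ν ρ => SignedW2.W2_triangle _ _ _
      eq_of_edist_eq_zero := fun {μ ν} h =>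
        Subtype.ext (SignedW2.eq_of_normalizedMeasure_eq hΩ_open hΩ_nonempty hΩ_bounded hσ hc
          μ.2 ν.2 (SignedW2.eq_of_W2_eq_zero h)) }
  -- The conversion keeps `edist` definitionally, hence the closing `rfl`.
  exact ⟨EMetricSpace.toMetricSpace fun μ ν =>
    SignedW2.W2_ne_top_of_second_moments (hmom μ μ.2) (hmom ν ν.2), fun μ ν => rfl⟩
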